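/- Setup. Let $p\in(2,\infty]$, let $q$ be its Hölder conjugate ($1/p+1/q=1$), and fix $d,r,T\in\mathbb N$ with $d,r\ge 1$ and reals $B,D>0$. Let $\mathbb X_p(D)$ be the collection of nonempty closed convex sets $\mathcal X\subseteq\mathbb R^d$ with $\max_{x,y\in\mathcal X}\|x-y\|_p\le D$. For such $\mathcal X$, let $\mathcal O_{\mathrm c,p}$ be the set of all pairs $(f,O)$ where $f:\mathcal X\to\mathbb R$ is convex and $O$ is a stochastic first-order oracle which, queried at $x\in\mathcal X$, returns a fresh random vector $\hat g(x)\in\mathbb R^d$ with $\mathbb E[\hat g(x)\mid x]\in\partial f(x)=\{g: f(y)\ge f(x)+\langle g,y-x\rangle\ \forall y\in\mathcal X\}$ and $\|\hat g(x)\|_q^2\le B^2$ almost surely. Let $\mathcal W_{\mathrm{com},r}$ be the set of all randomized channels (Markov kernels) $W:\mathbb R^d\to\{0,1\}^r$. An optimization algorithm $\pi$ with $T$ queries and an adaptive channel selection strategy $S$ proceed as follows (both may use a common random seed, independent of the oracle and of the channel noise): in round $t=1,\dots,T$ the algorithm queries a point $x_t\in\mathcal X$ and the strategy selects a channel $W_t\in\mathcal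 W_{\mathrm{com},r}$, both as functions of the seed and of the previous messages $Y_1,\dots,Y_{t-1}$; the oracle produces $\hat g(x_t)$, and the algorithm observes only $Y_t\sim W_t(\cdot\mid\hat g(x_t))$. After $T$ rounds the algorithm outputs a point $\hat x\in\mathcal X$, a function of the seed and of $Y_1,\dots,Y_T$. Put $\mathcal E(f,O,\pi,S)=\mathbb E\big[f(\hat x)-\min_{x\in\mathcal X}f(x)\big]$ and $$\mathcal E^*(\mathcal X,\mathcal O_{\mathrm c,p},T,\mathcal W_{\mathrm{com},r})=\inf_{\pi,S}\ \sup_{(f,O)\in\mathcal O_{\mathrm c,p}}\mathcal E(f,O,\pi,S).$$ Theorem. Let $c_0=\frac{1}{12\sqrt{58}}$, an absolute constant. For all $p\in(2,\infty]$, $B,D>0$, $d,r\ge1$ and all $T\ge\frac14\cdot\frac{d^2}{\min\{2^r,d\}}$, $$\sup_{\mathcal X\in\mathbb X_p(D)}\mathcal E^*(\mathcal X,\mathcal O_{\mathrm c,p},T,\mathcal W_{\mathrm{com},r})\ \ge\ \max\left\{\frac{c_0DB\,d^{1/2-1/p}}{\sqrt T}\sqrt{\frac{d}{\min\{d,2^r\}}},\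 \frac{c_0DB}{\sqrt T}\sqrt{\frac{d}{\min\{d,r\}}}\right\}.$$ -/

import Mathlib

open MeasureTheory ProbabilityTheory
open scoped ENNReal

noncomputable section

namespace InfoOpt

/-- The space `ℝ^d`. -/
abbrev E (d : ℕ) : Type := Fin d → ℝ

/-- The `ℓ_p` norm on `ℝ^d`, for `p ∈ [1, ∞]`. -/
def ellNorm {d : ℕ} (p : ℝ≥0∞) (x : E d) : ℝ := ‖WithLp.toLp p x‖

/-- The collection `𝕏_p(D)` of feasible domains: nonempty closed convex subsets of `ℝ^d`
whose `ℓ_p` diameter is at most `D`. -/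
def domains (d : ℕ) (p : ℝ≥0∞) (D : ℝ) : Set (Set (E d)) :=
  {X | X.Nonempty ∧ IsClosed X ∧ Convex ℝ X ∧ ∀ x ∈ X, ∀ y ∈ X, ellNorm p (x - y) ≤ D}

/-- The set of subgradients at `x` of a function `f` on the domain `X`. -/
def subdifferential {d : ℕ} (X : Set (E d)) (f : E d → ℝ) (x : E d) : Set (E d) :=
  {g | ∀ y ∈ X, f x + dotProduct g (y - x) ≤ f y}

/-- A (stochastic) first-order oracle on the domain `X`: the conditional law of the subgradient
estimate given the query point. -/
abbrev Oracle {d : ℕ} (X : Set (E d)) : Type := Kernel X (E d)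

/-- The convex and `ℓ_p` Lipschitz family `𝒪_{c,p}`: pairs `(f, O)` with `f` convex on `X`
(only the values of `f` on `X` matter) and `O` an oracle whose estimates are unbiased for a
subgradient and have `ℓ_q` norm at most `B` almost surely, `q` being the Hölder conjugate of
`p`. -/
def convexLipschitzFamily {d : ℕ} (X : Set (E d)) (p : ℝ≥0∞) (B : ℝ) :
    Set ((E d → ℝ) × Oracle X) :=
  {fO | ConvexOn ℝ X fO.1 ∧ IsMarkovKernel fO.2 ∧
    (∀ x : X, ∫ g, g ∂(fO.2 x) ∈ subdifferential X fO.1 x) ∧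
    (∀ x : X, ∀ᵐ g ∂(fO.2 x), ellNorm (ENNReal.conjExponent p) g ^ 2 ≤ B ^ 2)}

/-- The alphabet `{0,1}^r`. -/
abbrev Msg (r : ℕ) : Type := Fin r → Bool

/-- The family `𝒲_{com,r}` of `r`-bit communication-constrained channels: all (randomized)
channels from `ℝ^d` to `{0,1}^r`. -/
def comChannels (d r : ℕ) : Set (Kernel (E d) (Msg r)) := {W | IsMarkovKernel W}

section Protocols

variable {d : ℕ}

/-- A first-order optimization algorithm with `T` queries, whose randomness is the seed `u : Ω`.
The query of round `t` (rounds are numbered from `0`; only the rounds `t < T` are ever used) is a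
function of the seed and of the `t` messages received so far, and the final output is a function
of the seed and of all `T` messages. -/
structure Algorithm (X : Set (E d)) (T : ℕ) (Ω 𝒴 : Type) [MeasurableSpace Ω]
    [MeasurableSpace 𝒴] where
  query : ∀ t : ℕ, Ω × (Fin t → 𝒴) → X
  measurable_query : ∀ t, Measurable (query t)
  output : Ω × (Fin T → 𝒴) → X
  measurable_output : Measurable output

/-- An adaptive channel selection strategy for the channel family `𝒲`: given the seed and the
messages of the previous rounds, it selects a channel of `𝒲` for the current round. The selected
channel depends measurably on its arguments. -/
structure ChannelStrategy (𝒴 : Type) [MeasurableSpace 𝒴] (𝒲 : Set (Kernel (E d) 𝒴))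
    (Ω : Type) [MeasurableSpace Ω] where
  channel : ∀ t : ℕ, Kernel ((Ω × (Fin t → 𝒴)) × E d) 𝒴
  isMarkov : ∀ t, IsMarkovKernel (channel t)
  channel_mem : ∀ t (h : Ω × (Fin t → 𝒴)), (channel t).sectR h ∈ 𝒲

variable {X : Set (E d)} {T : ℕ} {Ω 𝒴 : Type} [MeasurableSpace Ω] [MeasurableSpace 𝒴]
  {𝒲 : Set (Kernel (E d) 𝒴)}

/-- One round: given the seed and the past messages, the algorithm queries a point, the oracle
returns a fresh subgradient estimate there, and the selected channel maps it to a message. This is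
the conditional law of that message. -/
def step (O : Oracle X) (π : Algorithm X T Ω 𝒴) (S : ChannelStrategy 𝒴 𝒲 Ω) (t : ℕ) :
    Kernel (Ω × (Fin t → 𝒴)) 𝒴 :=
  S.channel t ∘ₖ (Kernel.id ×ₖ O.comap (π.query t) (π.measurable_query t))

/-- The conditional law of the first `t` messages given the seed. -/
def transcript (O : Oracle X) (π : Algorithm X T Ω 𝒴) (S : ChannelStrategy 𝒴 𝒲 Ω) :
    (t : ℕ) → Kernel Ω (Fin t → 𝒴)
  | 0 => Kernel.const Ω (Measure.dirac Fin.elim0)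
  | t + 1 => (transcript O π S t ⊗ₖ step O π S t).map
      fun z => (Fin.snoc z.1 z.2 : Fin (t + 1) → 𝒴)

/-- The expected optimization error `𝓔(f, O, π, S) = 𝔼[f(x̂) - min_X f]` of the output `x̂`
after `T` rounds. -/
def optError (f : E d → ℝ) (O : Oracle X) (μ : Measure Ω) (π : Algorithm X T Ω 𝒴)
    (S : ChannelStrategy 𝒴 𝒲 Ω) : ℝ≥0∞ :=
  ∫⁻ z, ENNReal.ofReal (f (π.output z) - ⨅ x : X, f x) ∂(μ ⊗ₘ transcript O π S T)

end Protocols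

/-- The adaptive minmax optimization error `𝓔^*(X, 𝒪, T, 𝒲)`: the infimum over all algorithms and
adaptive channel selection strategies, sharing a random seed with any law `μ`, of the worst-case
optimization error over `𝒪`. -/
def minmaxError {d : ℕ} {𝒴 : Type} [MeasurableSpace 𝒴] (X : Set (E d))
    (𝒪 : Set ((E d → ℝ) × Oracle X)) (T : ℕ) (𝒲 : Set (Kernel (E d) 𝒴)) : ℝ≥0∞ :=
  ⨅ (Ω : Type) (_ : MeasurableSpace Ω) (μ : Measure Ω) (_ : IsProbabilityMeasure μ)
    (π : Algorithm X T Ω 𝒴) (S : ChannelStrategy 𝒴 𝒲 Ω),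
    ⨆ fO ∈ 𝒪, optError fO.1 fO.2 μ π S

end InfoOpt

end

/-!
The hard instances are linear functions on a cube. For a sign vector `v` and the cube of
`ℓ_p` diameter `D`, the objective is a multiple of `∑ i, sgn (v i) * x i`, and the oracle ignores
the query: it returns a random vector with finitely many values whose mean points in the direction
of `v`, with a small correlation `γ`. Two such gradient laws are used. In `coordLaw` the gradient
is `± B` times a uniformly random basis vector; in `prodLaw` it is a multiple of a random sign
vector with independent coordinates. An optimizer with small error must recover most of the
bits of `v`, so by Assouad's argument (`assouad`) it suffices that, on average over `i`, the laws
of the transcripts for `v` and for `v` with its `i`-th bit negated are close in total variation.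

Once the seed is fixed, a transcript is a random element of a finite set. By a form of Pinsker's
inequality (`sq_sum_abs_sub_le`) and the chain rule for relative entropy (`relEntropy_snoc`), the
closeness follows from a bound, valid for every channel, on the sum over `i` of the chi-square
divergences between the laws of a single `r`-bit message (`InfoBound`); the chain rule is what
handles adaptivity, because the sum over `i` is taken under the same law, that of `v`.

The one-round bounds are where the number of bits enters.
* For `coordLaw`, the deviations of the different bits are supported on disjoint events, and
  Bessel's inequality bounds the contribution of each of the `2 ^ r` message values
  (`sum_sum_sq_div_msgLaw_le_card`).
* For `prodLaw`, the deviations are independent and bounded, hence jointly subgaussian. The Gibbs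
  variational principle bounds the contribution of a message value `z` of probability `P z` by a
  multiple of `P z * log (P z)⁻¹` (`sum_sq_le_log_inv_of_mgf`), and the entropy of an `r`-bit
  message is at most `r * log 2`.
* In both cases data processing gives the bound without communication constraints
  (`sum_sq_div_msgLaw_le`).

The reduction is `le_minmaxError_cube`; the correlation is then chosen so that the bound on the
information in `T` rounds equals `d / 16`. The lower bound on `T` serves to keep this correlation
at most `1 / 16`.
-/

namespace InfoOpt

open Finset

/-! ### Relative entropy of finite distributions -/

/-- The relative entropy of the finite distribution `P` with respect to `Q`, in nats. Terms with
`P a = 0` or `Q a = 0` contribute `0`, so the value is the usual one only if `P` vanishes wherever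
`Q` does. -/
noncomputable def relEntropy {α : Type*} [Fintype α] (P Q : α → ℝ) : ℝ :=
  ∑ a, P a * Real.log (P a / Q a)

section Divergence

variable {α : Type*} [Fintype α] {P Q : α → ℝ}

/-- Relative entropy is at most the chi-square divergence. -/
theorem relEntropy_le_sum_sq_div (hP : ∀ a, 0 ≤ P a) (hQ : ∀ a, 0 ≤ Q a)
    (hPQ : ∀ a, Q a = 0 → P a = 0) (hsum : ∑ a, P a = ∑ a, Q a) :
    relEntropy P Q ≤ ∑ a, (P a - Q a) ^ 2 / Q a := by
  have key : ∀ a, P a * Real.log (P a / Q a) ≤ (P a - Q a) ^ 2 / Q a + (P a - Q a) := by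
    intro a
    rcases (hP a).eq_or_lt with h | h
    · rcases (hQ a).eq_or_lt with h' | h'
      · simp [← h, ← h']
      · rw [← h]
        apply le_of_eq
        field_simp
        ring
    · have h' : 0 < Q a := lt_of_le_of_ne (hQ a) fun h0 => h.ne' (hPQ a h0.symm)
      calc P a * Real.log (P a / Q a) ≤ P a * (P a / Q a - 1) := by
            gcongr
            exact Real.log_le_sub_one_of_pos (by positivity)
        _ = (P a - Q a) ^ 2 / Q a + (P a - Q a) := by
            field_simp
            ring
  calc relEntropy P Q ≤ ∑ a, ((P a - Q a) ^ 2 / Q a + (P a - Q a)) := sum_le_sum fun a _ => key a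
    _ = ∑ a, (P a - Q a) ^ 2 / Q a := by
      rw [sum_add_distrib, sum_sub_distrib, hsum, sub_self, add_zero]

/-- A form of Pinsker's inequality, obtained by comparing both sides with the Hellinger distance
`∑ a, (√(P a) - √(Q a)) ^ 2`. -/
theorem sq_sum_abs_sub_le (hP : ∀ a, 0 ≤ P a) (hQ : ∀ a, 0 ≤ Q a)
    (hPQ : ∀ a, Q a = 0 → P a = 0) (hP1 : ∑ a, P a = 1) (hQ1 : ∑ a, Q a = 1) :
    (∑ a, |P a - Q a|) ^ 2 ≤ 4 * relEntropy P Q := by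
  have hterm : ∀ a, (√(P a) - √(Q a)) ^ 2 + P a - Q a ≤ P a * Real.log (P a / Q a) := by
    intro a
    have hp := Real.sq_sqrt (hP a)
    have hq := Real.sq_sqrt (hQ a)
    rcases (hP a).eq_or_lt with h | h
    · simp [← h, hq]
    · have h' : 0 < Q a := lt_of_le_of_ne (hQ a) fun h0 => h.ne' (hPQ a h0.symm)
      have hsp := Real.sqrt_pos.2 h
      have hsq := Real.sqrt_pos.2 h'
      have h1 : Real.log (√(Q a) / √(P a)) ≤ √(Q a) / √(P a) - 1 :=
        Real.log_le_sub_one_of_pos (by positivity)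
      have h2 : Real.log (P a / Q a) = -2 * Real.log (√(Q a) / √(P a)) := by
        rw [Real.log_div h.ne' h'.ne', Real.log_div hsq.ne' hsp.ne', Real.log_sqrt (hP a),
          Real.log_sqrt (hQ a)]
        ring
      have h3 : P a * (√(Q a) / √(P a)) = √(P a) * √(Q a) := by
        rw [← hp]
        field_simp
        rw [Real.sqrt_sq hsp.le]
      rw [h2]
      nlinarith [mul_le_mul_of_nonneg_left h1 (hP a)]
  have hH : ∑ a, (√(P a) - √(Q a)) ^ 2 ≤ relEntropy P Q := by
    have := sum_le_sum fun a (_ : a ∈ univ) => hterm a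
    rw [sum_sub_distrib, sum_add_distrib, hP1, hQ1] at this
    simpa [relEntropy] using this
  have hplus : ∑ a, (√(P a) + √(Q a)) ^ 2 ≤ 4 := by
    calc ∑ a, (√(P a) + √(Q a)) ^ 2 ≤ ∑ a, (2 * P a + 2 * Q a) := by
          refine sum_le_sum fun a _ => ?_
          nlinarith [Real.sq_sqrt (hP a), Real.sq_sqrt (hQ a), sq_nonneg (√(P a) - √(Q a))]
      _ = 4 := by
          rw [sum_add_distrib, ← mul_sum, ← mul_sum, hP1, hQ1]
          norm_num
  calc (∑ a, |P a - Q a|) ^ 2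
      ≤ (∑ a, (√(P a) - √(Q a)) ^ 2) * ∑ a, (√(P a) + √(Q a)) ^ 2 := by
        refine sum_sq_le_sum_mul_sum_of_sq_le_mul _ (fun _ _ => sq_nonneg _)
          (fun _ _ => sq_nonneg _) fun a _ => le_of_eq ?_
        rw [sq_abs, ← mul_pow]
        congr 1
        nlinarith [Real.sq_sqrt (hP a), Real.sq_sqrt (hQ a)]
    _ ≤ relEntropy P Q * 4 := by
        have h0 : 0 ≤ ∑ a, (√(P a) - √(Q a)) ^ 2 := sum_nonneg fun _ _ => sq_nonneg _
        gcongr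
        exact h0.trans hH
    _ = _ := mul_comm _ _

end Divergence

theorem sum_fin_succ_eq_sum_snoc {Z : Type*} [Fintype Z] {t : ℕ} (F : (Fin (t + 1) → Z) → ℝ) :
    ∑ y, F y = ∑ y : Fin t → Z, ∑ z, F (Fin.snoc y z) := by
  rw [← (Fin.snocEquiv fun _ : Fin (t + 1) => Z).sum_comp, Fintype.sum_prod_type, sum_comm]
  rfl

/-- The chain rule for relative entropy, when one more message is appended to a transcript. -/
theorem relEntropy_snoc {Z : Type*} [Fintype Z] {t : ℕ} {P Q : (Fin t → Z) → ℝ}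
    {p q : (Fin t → Z) → Z → ℝ} {P' Q' : (Fin (t + 1) → Z) → ℝ}
    (hP' : ∀ y z, P' (Fin.snoc y z) = P y * p y z) (hQ' : ∀ y z, Q' (Fin.snoc y z) = Q y * q y z)
    (hPQ : ∀ y, Q y = 0 → P y = 0) (hpq : ∀ y z, q y z = 0 → p y z = 0)
    (hp : ∀ y, ∑ z, p y z = 1) :
    relEntropy P' Q' = relEntropy P Q + ∑ y, P y * relEntropy (p y) (q y) := by
  unfold relEntropy
  rw [sum_fin_succ_eq_sum_snoc, ← sum_add_distrib]
  refine sum_congr rfl fun y _ => ?_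
  rw [← mul_one (P y * Real.log (P y / Q y)), ← hp y, mul_sum, mul_sum, ← sum_add_distrib]
  refine sum_congr rfl fun z _ => ?_
  rw [hP', hQ']
  by_cases hP0 : P y = 0
  · simp [hP0]
  by_cases hp0 : p y z = 0
  · simp [hp0]
  have hQ0 := mt (hPQ y) hP0
  have hq0 := mt (hpq y z) hp0
  rw [mul_div_mul_comm, Real.log_mul (div_ne_zero hP0 hQ0) (div_ne_zero hp0 hq0)]
  ring

/-! ### Hypercube averaging -/

/-- The real sign of a Boolean. -/
def sgn (b : Bool) : ℝ := if b then 1 else -1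

theorem sgn_not (b : Bool) : sgn (!b) = -sgn b := by cases b <;> simp [sgn]

theorem sgn_mul_self (b : Bool) : sgn b * sgn b = 1 := by cases b <;> simp [sgn]

theorem abs_sgn (b : Bool) : |sgn b| = 1 := by cases b <;> simp [sgn]

variable {d : ℕ}

/-- The vertex of the Boolean cube obtained from `v` by negating its `i`-th coordinate. -/
def flipAt (v : Fin d → Bool) (i : Fin d) : Fin d → Bool := Function.update v i (!v i)

@[simp] theorem flipAt_self (v : Fin d → Bool) (i : Fin d) : flipAt v i i = !v i := by
  simp [flipAt]

theorem flipAt_of_ne (v : Fin d → Bool) {i j : Fin d} (h : j ≠ i) : flipAt v i j = v j := by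
  simp [flipAt, h]

theorem flipAt_flipAt (v : Fin d → Bool) (i : Fin d) : flipAt (flipAt v i) i = v := by
  simp [flipAt]

theorem sum_flipAt (i : Fin d) (F : (Fin d → Bool) → ℝ) : ∑ v, F (flipAt v i) = ∑ v, F v :=
  Equiv.sum_comp (Function.Involutive.toPerm (fun v => flipAt v i) fun v => flipAt_flipAt v i) F

/-- Assouad's argument: if flipping one bit of `v` hardly changes the distribution `P v`, then
an estimate `x` with coordinates in `[-a, a]` is badly correlated with `v` on average. -/
theorem assouad {Y : Type*} [Fintype Y] {P : (Fin d → Bool) → Y → ℝ} {x : Y → Fin d → ℝ}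
    {a : ℝ} (hP : ∀ v y, 0 ≤ P v y) (hP1 : ∀ v, ∑ y, P v y = 1)
    (hPP : ∀ v i y, P (flipAt v i) y = 0 → P v y = 0) (hx : ∀ y i, |x y i| ≤ a)
    (hKL : ∀ v, ∑ i, relEntropy (P v) (P (flipAt v i)) ≤ d / 16) :
    2 ^ d * (3 / 4 * a * d) ≤ ∑ v, ∑ y, P v y * ∑ i, (a + sgn (v i) * x y i) := by
  rcases Nat.eq_zero_or_pos d with rfl | hd
  · simp
  have ha : 0 ≤ a := by
    obtain ⟨y⟩ : Nonempty Y := by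
      by_contra h
      rw [not_nonempty_iff] at h
      simpa using hP1 fun _ => true
    exact (abs_nonneg _).trans (hx y ⟨0, hd⟩)
  set L : (Fin d → Bool) → Fin d → ℝ := fun v i => ∑ y, |P v y - P (flipAt v i) y| with hL
  have hLsum : ∀ v, ∑ i, L v i ≤ d / 2 := by
    intro v
    have h1 : (∑ i, L v i) ^ 2 ≤ d * ∑ i, L v i ^ 2 := by
      simpa using sq_sum_le_card_mul_sum_sq (s := univ) (f := L v)
    have h2 : ∑ i, L v i ^ 2 ≤ 4 * (d / 16) := by
      refine le_trans (sum_le_sum fun i _ => sq_sum_abs_sub_le (hP v) (hP _) (hPP v i) (hP1 v)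
        (hP1 _)) ?_
      rw [← mul_sum]
      gcongr
      exact hKL v
    refine abs_le_of_sq_le_sq' ?_ (by positivity) |>.2
    nlinarith [(Nat.cast_nonneg d : (0 : ℝ) ≤ d)]
  set m : (Fin d → Bool) → Fin d → ℝ := fun v i => ∑ y, P v y * x y i with hm
  have hmL : ∀ v i, -(a * L v i) ≤ sgn (v i) * (m v i - m (flipAt v i) i) := by
    intro v i
    have : |sgn (v i) * (m v i - m (flipAt v i) i)| ≤ a * L v i := by
      rw [abs_mul, abs_sgn, one_mul, hm, hL]
      simp only
      rw [← sum_sub_distrib, mul_sum]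
      refine (abs_sum_le_sum_abs _ _).trans (sum_le_sum fun y _ => ?_)
      rw [← sub_mul, abs_mul, mul_comm]
      gcongr
      exact hx y i
    exact (abs_le.1 this).1
  -- The flip is an involution of the cube, so each bit may be averaged with its negation.
  have hpair : ∀ i, ∑ v, sgn (v i) * m v i
      = (∑ v, sgn (v i) * (m v i - m (flipAt v i) i)) / 2 := by
    intro i
    have h := sum_flipAt i fun v => sgn (v i) * m v i
    simp only [flipAt_self, sgn_not, neg_mul, sum_neg_distrib] at h
    simp only [mul_sub, sum_sub_distrib]
    linarith
  have hcorr : -(2 ^ d * (a * d / 4)) ≤ ∑ i, ∑ v, sgn (v i) * m v i := by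
    calc -(2 ^ d * (a * d / 4)) = ∑ v : Fin d → Bool, -(a * (d / 2) / 2) := by
          simp
          ring
      _ ≤ ∑ v, -(a * (∑ i, L v i) / 2) := by
          refine sum_le_sum fun v _ => ?_
          have := mul_le_mul_of_nonneg_left (hLsum v) ha
          linarith
      _ = ∑ i, ∑ v, -(a * L v i) / 2 := by
          rw [sum_comm]
          refine sum_congr rfl fun v _ => ?_
          rw [mul_sum, sum_div, ← sum_neg_distrib]
          exact sum_congr rfl fun i _ => by ring
      _ ≤ ∑ i, ∑ v, sgn (v i) * m v i := by
          refine sum_le_sum fun i _ => ?_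
          rw [hpair, sum_div]
          refine sum_le_sum fun v _ => ?_
          linarith [hmL v i]
  have hsplit : ∀ v, ∑ y, P v y * ∑ i, (a + sgn (v i) * x y i)
      = a * d + ∑ i, sgn (v i) * m v i := by
    intro v
    have h1 : ∀ y, P v y * ∑ i, (a + sgn (v i) * x y i)
        = a * d * P v y + ∑ i, sgn (v i) * (P v y * x y i) := by
      intro y
      rw [sum_add_distrib, mul_add]
      congr 1
      · simp
        ring
      · rw [mul_sum]
        exact sum_congr rfl fun i _ => by ring
    rw [sum_congr rfl fun y _ => h1 y, sum_add_distrib, ← mul_sum, hP1, mul_one]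
    congr 1
    rw [sum_comm]
    simp only [hm, mul_sum]
  rw [sum_congr rfl fun v _ => hsplit v, sum_add_distrib,
    sum_comm (f := fun v i => sgn (v i) * m v i)]
  have : ∑ _v : Fin d → Bool, a * (d : ℝ) = 2 ^ d * (a * d) := by simp
  rw [this]
  linarith

/-! ### Information about each bit carried by one message -/

section OneRound

variable {S Z : Type*} [Fintype S]

/-- The distribution of the message when the input, of law `w`, is sent through the channel
`W`. -/
noncomputable def msgLaw (w : S → ℝ) (W : S → Z → ℝ) (z : Z) : ℝ := ∑ s, w s * W s z

theorem msgLaw_nonneg {w : S → ℝ} {W : S → Z → ℝ} (hw : ∀ s, 0 < w s) (hW : ∀ s z, 0 ≤ W s z)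
    (z : Z) : 0 ≤ msgLaw w W z :=
  sum_nonneg fun s _ => mul_nonneg (hw s).le (hW s z)

theorem msgLaw_eq_zero_iff {w : S → ℝ} {W : S → Z → ℝ} (hw : ∀ s, 0 < w s)
    (hW : ∀ s z, 0 ≤ W s z) (z : Z) : msgLaw w W z = 0 ↔ ∀ s, W s z = 0 := by
  unfold msgLaw
  rw [sum_eq_zero_iff_of_nonneg fun s _ => mul_nonneg (hw s).le (hW s z)]
  simp [(hw _).ne']

theorem sum_msgLaw [Fintype Z] {w : S → ℝ} {W : S → Z → ℝ} (hw1 : ∑ s, w s = 1)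
    (hW1 : ∀ s, ∑ z, W s z = 1) :
    ∑ z, msgLaw w W z = 1 := by
  unfold msgLaw
  rw [sum_comm]
  simp [← mul_sum, hW1, hw1]

/-- The chi-square divergence between the two message laws, written in terms of the relative
deviation `φ` of the two input laws. -/
theorem chiSq_msgLaw_le [Fintype Z] {w w' φ : S → ℝ} {W : S → Z → ℝ} (hw : ∀ s, 0 < w s)
    (hW : ∀ s z, 0 ≤ W s z) (hw' : ∀ s, w' s = w s * (1 + φ s)) (hφ : ∀ s, -(1 / 2) ≤ φ s) :
    ∑ z, (msgLaw w W z - msgLaw w' W z) ^ 2 / msgLaw w' W z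
      ≤ 2 * ∑ z, (∑ s, w s * W s z * φ s) ^ 2 / msgLaw w W z := by
  rw [mul_sum]
  refine sum_le_sum fun z _ => ?_
  have hdiff : msgLaw w' W z - msgLaw w W z = ∑ s, w s * W s z * φ s := by
    unfold msgLaw
    rw [← sum_sub_distrib]
    refine sum_congr rfl fun s _ => ?_
    rw [hw']
    ring
  have hhalf : msgLaw w W z / 2 ≤ msgLaw w' W z := by
    unfold msgLaw
    rw [sum_div]
    refine sum_le_sum fun s _ => ?_
    rw [hw']
    have := mul_nonneg (hw s).le (hW s z)
    nlinarith [hφ s]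
  rw [← neg_sub, neg_sq, hdiff]
  rcases (msgLaw_nonneg hw hW z).eq_or_lt with h | h
  · have h0 := (msgLaw_eq_zero_iff hw hW z).1 h.symm
    simp [h0]
  · calc (∑ s, w s * W s z * φ s) ^ 2 / msgLaw w' W z
        ≤ (∑ s, w s * W s z * φ s) ^ 2 / (msgLaw w W z / 2) := by gcongr
      _ = 2 * ((∑ s, w s * W s z * φ s) ^ 2 / msgLaw w W z) := by
          field_simp

/-- Data processing: a message reveals no more about the deviation `φ` than the input does. -/
theorem sum_sq_div_msgLaw_le [Fintype Z] {w φ : S → ℝ} {W : S → Z → ℝ} (hw : ∀ s, 0 < w s)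
    (hW : ∀ s z, 0 ≤ W s z) (hW1 : ∀ s, ∑ z, W s z = 1) :
    ∑ z, (∑ s, w s * W s z * φ s) ^ 2 / msgLaw w W z ≤ ∑ s, w s * φ s ^ 2 := by
  calc ∑ z, (∑ s, w s * W s z * φ s) ^ 2 / msgLaw w W z
      ≤ ∑ z, ∑ s, w s * W s z * φ s ^ 2 := by
        refine sum_le_sum fun z _ => ?_
        have hnn : ∀ s, 0 ≤ w s * W s z := fun s => mul_nonneg (hw s).le (hW s z)
        refine div_le_of_le_mul₀ (msgLaw_nonneg hw hW z)
          (sum_nonneg fun s _ => mul_nonneg (hnn s) (sq_nonneg _)) ?_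
        rw [mul_comm]
        refine sum_sq_le_sum_mul_sum_of_sq_le_mul _ (fun s _ => hnn s)
          (fun s _ => mul_nonneg (hnn s) (sq_nonneg _)) fun s _ => le_of_eq (by ring)
    _ = ∑ s, w s * φ s ^ 2 := by
        rw [sum_comm]
        refine sum_congr rfl fun s _ => ?_
        rw [← sum_mul, ← mul_sum, hW1, mul_one]

/-- Bessel's inequality for deviations supported on disjoint blocks: every single message value
contributes at most the common variance `c`. -/
theorem sum_sum_sq_div_msgLaw_le_card [Fintype Z] {d : ℕ} {w : S → ℝ} {φ : Fin d → S → ℝ}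
    {W : S → Z → ℝ}
    (hw : ∀ s, 0 < w s) (hW : ∀ s z, 0 ≤ W s z) (hWle : ∀ s z, W s z ≤ 1) (block : S → Fin d)
    (hφ : ∀ i s, block s ≠ i → φ i s = 0) {c : ℝ} (hc : 0 ≤ c)
    (hvar : ∀ i, ∑ s, w s * φ i s ^ 2 ≤ c) :
    ∑ i, ∑ z, (∑ s, w s * W s z * φ i s) ^ 2 / msgLaw w W z ≤ Fintype.card Z * c := by
  rw [sum_comm]
  refine (sum_le_card_nsmul univ _ c fun z _ => ?_).trans_eq (by simp)
  rw [← sum_div]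
  refine div_le_of_le_mul₀ (msgLaw_nonneg hw hW z) hc ?_
  have hterm : ∀ i, (∑ s, w s * W s z * φ i s) ^ 2
      ≤ c * ∑ s, if i = block s then w s * W s z else 0 := by
    intro i
    have hnn : ∀ s, 0 ≤ if i = block s then w s * W s z else 0 := fun s => by
      split_ifs
      exacts [mul_nonneg (hw s).le (hW s z), le_rfl]
    calc (∑ s, w s * W s z * φ i s) ^ 2
        ≤ (∑ s, w s * φ i s ^ 2) * ∑ s, if i = block s then w s * W s z else 0 := by
          refine sum_sq_le_sum_mul_sum_of_sq_le_mul _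
            (fun s _ => mul_nonneg (hw s).le (sq_nonneg _)) (fun s _ => hnn s) fun s _ => ?_
          split_ifs with h
          · calc (w s * W s z * φ i s) ^ 2 = (w s * φ i s) ^ 2 * (W s z * W s z) := by ring
              _ ≤ (w s * φ i s) ^ 2 * (1 * W s z) := by
                  gcongr
                  exacts [hW s z, hWle s z]
              _ = w s * φ i s ^ 2 * (w s * W s z) := by ring
          · simp [hφ i s (Ne.symm h)]
      _ ≤ _ := by
          gcongr
          exacts [sum_nonneg fun s _ => hnn s, hvar i]
  refine (sum_le_sum fun i _ => hterm i).trans_eq ?_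
  rw [← mul_sum, sum_comm]
  simp [msgLaw]

/-- The Gibbs variational bound: conditioning a law `w` on an event of probability `P` (more
generally, reweighting it by `f` with values in `[0, 1]`) shifts the means of subgaussian
variables `φ i` by a vector of squared length at most `4 * c * log P⁻¹`. -/
theorem sum_sq_le_log_inv_of_mgf {d : ℕ} {w f : S → ℝ} {φ : Fin d → S → ℝ} (hw : ∀ s, 0 < w s)
    (hf : ∀ s, 0 ≤ f s) (hf1 : ∀ s, f s ≤ 1) {c : ℝ} (hc : 0 < c)
    (hmgf : ∀ l : Fin d → ℝ, ∑ s, w s * Real.exp (∑ i, l i * φ i s) ≤ Real.exp (c * ∑ i, l i ^ 2))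
    {P : ℝ} (hP : P = ∑ s, w s * f s) (hP0 : 0 < P) :
    ∑ i, (∑ s, w s * f s * φ i s) ^ 2 / P ≤ 4 * c * (P * Real.log P⁻¹) := by
  set m : Fin d → ℝ := fun i => (∑ s, w s * f s * φ i s) / P with hm
  -- The optimal exponential tilt of the Gibbs bound is in the direction of the shift itself.
  set l : Fin d → ℝ := fun i => m i / (2 * c) with hl
  set N : ℝ := ∑ i, m i ^ 2 with hN
  set μ : ℝ := ∑ i, l i * m i with hμ
  have hμN : μ = N / (2 * c) := by
    rw [hμ, hN, sum_div]
    exact sum_congr rfl fun i _ => by simp only [hl]; ring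
  have hlN : c * ∑ i, l i ^ 2 = N / (4 * c) := by
    rw [hN, sum_div, mul_sum]
    refine sum_congr rfl fun i _ => ?_
    simp only [hl]
    field_simp
    ring
  have hmean : ∑ s, w s * f s * ∑ i, l i * φ i s = P * μ := by
    simp only [hμ, mul_sum]
    rw [sum_comm]
    refine sum_congr rfl fun i _ => ?_
    have : ∑ s, w s * f s * φ i s = P * m i := by
      simp only [hm]
      field_simp
    calc ∑ s, w s * f s * (l i * φ i s) = l i * ∑ s, w s * f s * φ i s := by
          rw [mul_sum]
          exact sum_congr rfl fun s _ => by ring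
      _ = P * (l i * m i) := by
          rw [this]
          ring
  have hexp : P * Real.exp μ ≤ Real.exp (N / (4 * c)) := by
    rw [← hlN]
    refine le_trans ?_ (hmgf l)
    calc P * Real.exp μ
        = ∑ s, w s * f s * (Real.exp μ * (1 + (∑ i, l i * φ i s - μ))) := by
          have : ∀ s, w s * f s * (Real.exp μ * (1 + (∑ i, l i * φ i s - μ)))
              = Real.exp μ * ((1 - μ) * (w s * f s) + w s * f s * ∑ i, l i * φ i s) := by
            intro s
            ring
          rw [sum_congr rfl fun s _ => this s, ← mul_sum, sum_add_distrib, ← mul_sum, hmean, ← hP]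
          ring
      _ ≤ ∑ s, w s * Real.exp (∑ i, l i * φ i s) := by
          refine sum_le_sum fun s _ => ?_
          have h1 : Real.exp μ * (1 + (∑ i, l i * φ i s - μ)) ≤ Real.exp (∑ i, l i * φ i s) := by
            have := Real.add_one_le_exp (∑ i, l i * φ i s - μ)
            calc _ ≤ Real.exp μ * Real.exp (∑ i, l i * φ i s - μ) := by
                  gcongr
                  linarith
              _ = _ := by
                  rw [← Real.exp_add]
                  congr 1
                  ring
          calc _ ≤ w s * f s * Real.exp (∑ i, l i * φ i s) :=
                mul_le_mul_of_nonneg_left h1 (mul_nonneg (hw s).le (hf s))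
            _ ≤ w s * 1 * Real.exp (∑ i, l i * φ i s) := by
                gcongr
                exacts [(hw s).le, hf1 s]
            _ = _ := by rw [mul_one]
  have hlog : N / (4 * c) ≤ Real.log P⁻¹ := by
    have h1 := Real.log_le_log (by positivity) hexp
    rw [Real.log_mul hP0.ne' (Real.exp_pos _).ne', Real.log_exp, Real.log_exp, hμN] at h1
    rw [Real.log_inv]
    have h2 : N / (2 * c) = N / (4 * c) + N / (4 * c) := by
      field_simp
      ring
    linarith
  have hfin : ∑ i, (∑ s, w s * f s * φ i s) ^ 2 / P = P * N := by
    rw [hN, mul_sum]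
    refine sum_congr rfl fun i _ => ?_
    simp only [hm]
    field_simp
  rw [hfin]
  rw [div_le_iff₀ (by positivity)] at hlog
  calc P * N ≤ P * (Real.log P⁻¹ * (4 * c)) := by gcongr
    _ = _ := by ring

/-- The Shannon entropy of a distribution on `Z` is at most `log (card Z)`. -/
theorem sum_mul_log_inv_le [Fintype Z] {P : Z → ℝ} (hP : ∀ z, 0 ≤ P z) (hP1 : ∑ z, P z = 1) :
    ∑ z, P z * Real.log (P z)⁻¹ ≤ Real.log (Fintype.card Z) := by
  obtain ⟨z₀⟩ : Nonempty Z := by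
    by_contra h
    rw [not_nonempty_iff] at h
    simp at hP1
  set n : ℝ := (Fintype.card Z : ℝ) with hn
  have hn0 : 0 < n := by
    rw [hn]
    exact_mod_cast Fintype.card_pos_iff.2 ⟨z₀⟩
  have hterm : ∀ z, P z * Real.log (P z)⁻¹ ≤ P z * Real.log n + (n⁻¹ - P z) := by
    intro z
    rcases (hP z).eq_or_lt with h | h
    · simp [← h, hn0.le]
    · have h1 : Real.log ((P z)⁻¹ * n⁻¹) ≤ (P z)⁻¹ * n⁻¹ - 1 :=
        Real.log_le_sub_one_of_pos (by positivity)
      rw [Real.log_mul (by positivity) (by positivity), Real.log_inv n] at h1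
      have h2 := mul_le_mul_of_nonneg_left h1 h.le
      have h3 : P z * ((P z)⁻¹ * n⁻¹ - 1) = n⁻¹ - P z := by field_simp
      linarith
  refine (sum_le_sum fun z _ => hterm z).trans_eq ?_
  rw [sum_add_distrib, sum_sub_distrib, ← sum_mul, hP1]
  simp [← hn, hn0.ne']

/-- A message from `Z` reveals about all the subgaussian deviations `φ i` together at most a
multiple of its entropy. -/
theorem sum_sum_sq_div_msgLaw_le_log [Fintype Z] {d : ℕ} {w : S → ℝ} {φ : Fin d → S → ℝ}
    {W : S → Z → ℝ}
    (hw : ∀ s, 0 < w s) (hw1 : ∑ s, w s = 1) (hW : ∀ s z, 0 ≤ W s z) (hWle : ∀ s z, W s z ≤ 1)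
    (hW1 : ∀ s, ∑ z, W s z = 1) {c : ℝ} (hc : 0 < c)
    (hmgf : ∀ l : Fin d → ℝ,
      ∑ s, w s * Real.exp (∑ i, l i * φ i s) ≤ Real.exp (c * ∑ i, l i ^ 2)) :
    ∑ i, ∑ z, (∑ s, w s * W s z * φ i s) ^ 2 / msgLaw w W z
      ≤ 4 * c * Real.log (Fintype.card Z) := by
  calc ∑ i, ∑ z, (∑ s, w s * W s z * φ i s) ^ 2 / msgLaw w W z
      ≤ ∑ z, 4 * c * (msgLaw w W z * Real.log (msgLaw w W z)⁻¹) := by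
        rw [sum_comm]
        refine sum_le_sum fun z _ => ?_
        rcases (msgLaw_nonneg hw hW z).eq_or_lt with h | h
        · simp [← h]
        · exact sum_sq_le_log_inv_of_mgf hw (fun s => hW s z) (fun s => hWle s z) hc hmgf rfl h
    _ ≤ _ := by
        rw [← mul_sum]
        gcongr
        exact sum_mul_log_inv_le (msgLaw_nonneg hw hW) (sum_msgLaw hw1 hW1)

end OneRound

theorem exp_le_add_exp_sq (x : ℝ) : Real.exp x ≤ x + Real.exp (x ^ 2) := by
  have hsq := Real.add_one_le_exp (x ^ 2)
  rcases le_or_gt |x| 1 with h | h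
  · have := (abs_le.1 (Real.abs_exp_sub_one_sub_id_le h)).2
    linarith
  · rcases lt_abs.1 h with h | h
    · have : Real.exp x ≤ Real.exp (x ^ 2) := Real.exp_le_exp.2 (by nlinarith)
      linarith
    · have : Real.exp x ≤ 1 := Real.exp_le_one_iff.2 (by linarith)
      nlinarith

/-- Independent centred variables bounded by `b` are jointly subgaussian. -/
theorem mgf_prod_le {d : ℕ} {κ : Type*} [Fintype κ] {u ψ : Fin d → κ → ℝ} {b : ℝ}
    (hu : ∀ i k, 0 ≤ u i k) (hu1 : ∀ i, ∑ k, u i k = 1) (hmean : ∀ i, ∑ k, u i k * ψ i k = 0)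
    (hψ : ∀ i k, ψ i k ^ 2 ≤ b) (l : Fin d → ℝ) :
    ∑ s : Fin d → κ, (∏ i, u i (s i)) * Real.exp (∑ i, l i * ψ i (s i))
      ≤ Real.exp (b * ∑ i, l i ^ 2) := by
  have h1 : ∀ s : Fin d → κ, (∏ i, u i (s i)) * Real.exp (∑ i, l i * ψ i (s i))
      = ∏ i, u i (s i) * Real.exp (l i * ψ i (s i)) := fun s => by
    rw [Real.exp_sum, prod_mul_distrib]
  rw [sum_congr rfl fun s _ => h1 s,
    ← Fintype.prod_sum fun i k => u i k * Real.exp (l i * ψ i k), mul_sum, Real.exp_sum]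
  refine prod_le_prod (fun i _ => sum_nonneg fun k _ => mul_nonneg (hu i k) (Real.exp_pos _).le)
    fun i _ => ?_
  calc ∑ k, u i k * Real.exp (l i * ψ i k)
      ≤ ∑ k, (l i * (u i k * ψ i k) + u i k * Real.exp (b * l i ^ 2)) := by
        refine sum_le_sum fun k _ => ?_
        have h2 : Real.exp ((l i * ψ i k) ^ 2) ≤ Real.exp (b * l i ^ 2) := by
          rw [Real.exp_le_exp, mul_pow, mul_comm]
          gcongr
          exact hψ i k
        have h3 := mul_le_mul_of_nonneg_left
          ((exp_le_add_exp_sq (l i * ψ i k)).trans (add_le_add_right h2 _)) (hu i k)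
        linarith
    _ = Real.exp (b * l i ^ 2) := by
        rw [sum_add_distrib, ← mul_sum, hmean, ← sum_mul, hu1]
        ring

/-! ### Two families of gradient laws indexed by the Boolean cube -/

/-- The law of a random bit whose correlation with the bit `a` is `γ`. -/
noncomputable def bitLaw (γ : ℝ) (a b : Bool) : ℝ := (1 + γ * sgn a * sgn b) / 2

/-- The relative change of `bitLaw γ a b` when `a` is negated. -/
noncomputable def bitDev (γ : ℝ) (a b : Bool) : ℝ :=
  -(2 * (γ * sgn a * sgn b)) / (1 + γ * sgn a * sgn b)

theorem sum_bitLaw (γ : ℝ) (a : Bool) : ∑ b, bitLaw γ a b = 1 := by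
  cases a <;> simp [bitLaw, sgn] <;> ring

theorem sum_bitLaw_mul_sgn (γ : ℝ) (a : Bool) : ∑ b, bitLaw γ a b * sgn b = γ * sgn a := by
  cases a <;> simp [bitLaw, sgn] <;> ring

section BitBounds

variable {γ : ℝ} (hγ : 0 ≤ γ) (hγ1 : γ ≤ 1 / 16) (a b : Bool)
include hγ hγ1

theorem bitLaw_pos : 0 < bitLaw γ a b := by
  cases a <;> cases b <;> simp [bitLaw, sgn] <;> linarith

theorem bitLaw_not : bitLaw γ (!a) b = bitLaw γ a b * (1 + bitDev γ a b) := by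
  have h1 : 1 + γ ≠ 0 := by linarith
  have h2 : 1 + -γ ≠ 0 := by linarith
  cases a <;> cases b <;> simp [bitLaw, bitDev, sgn] <;> field_simp <;> ring

theorem sum_bitLaw_mul_bitDev : ∑ b, bitLaw γ a b * bitDev γ a b = 0 := by
  have h := sum_bitLaw γ (!a)
  simp only [bitLaw_not hγ hγ1, mul_add, mul_one, sum_add_distrib, sum_bitLaw] at h
  linarith

theorem bitDev_sq_le : bitDev γ a b ^ 2 ≤ 25 / 4 * γ ^ 2 := by
  have h1 : 0 < 1 + γ := by linarith
  have h2 : 0 < 1 + -γ := by linarith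
  have h3 : (2 * γ) ^ 2 / (1 + γ) ^ 2 ≤ 25 / 4 * γ ^ 2 := by
    rw [div_le_iff₀ (by positivity)]
    nlinarith [mul_nonneg (sq_nonneg γ) hγ, sq_nonneg (γ ^ 2), sq_nonneg γ]
  have h4 : (2 * γ) ^ 2 / (1 + -γ) ^ 2 ≤ 25 / 4 * γ ^ 2 := by
    rw [div_le_iff₀ (by positivity)]
    have : (15 / 16 : ℝ) ^ 2 ≤ (1 + -γ) ^ 2 := by
      gcongr
      linarith
    nlinarith [mul_le_mul_of_nonneg_left this (sq_nonneg γ), sq_nonneg γ]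
  cases a <;> cases b <;> simp only [bitDev, sgn, if_true, mul_one, mul_neg, neg_neg, div_pow,
    neg_sq, Bool.false_eq_true, if_false] <;> assumption

theorem neg_half_le_bitDev : -(1 / 2) ≤ bitDev γ a b := by
  have h := bitDev_sq_le hγ hγ1 a b
  have : bitDev γ a b ^ 2 ≤ (1 / 2) ^ 2 := by nlinarith
  exact (abs_le_of_sq_le_sq' this (by norm_num)).1

end BitBounds

variable {d : ℕ}

/-- Independent random bits, the `j`-th of which has correlation `γ` with `v j`. -/
noncomputable def prodLaw (γ : ℝ) (v : Fin d → Bool) (s : Fin d → Bool) : ℝ :=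
  ∏ j, bitLaw γ (v j) (s j)

/-- A uniformly random coordinate `j` together with a random bit that has correlation `γ` with
`v j`. -/
noncomputable def coordLaw (γ : ℝ) (v : Fin d → Bool) (s : Fin d × Bool) : ℝ :=
  bitLaw γ (v s.1) s.2 / d

/-- One `r`-bit message about an input of law `w v` yields, summed over the bits `i` of `v`,
chi-square divergences of total size at most `K` between the laws that correspond to `v` and
`flipAt v i`. -/
def InfoBound {S : Type*} [Fintype S] (r : ℕ) (w : (Fin d → Bool) → S → ℝ) (K : ℝ) : Prop :=
  ∀ v (W : S → Msg r → ℝ), (∀ s z, 0 ≤ W s z) → (∀ s, ∑ z, W s z = 1) →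
    ∑ i, ∑ z, (msgLaw (w v) W z - msgLaw (w (flipAt v i)) W z) ^ 2 / msgLaw (w (flipAt v i)) W z
      ≤ K

theorem sum_prodLaw (γ : ℝ) (v : Fin d → Bool) : ∑ s, prodLaw γ v s = 1 := by
  unfold prodLaw
  rw [← Fintype.prod_sum fun j b => bitLaw γ (v j) b]
  simp only [sum_bitLaw, prod_const_one]

theorem sum_prodLaw_mul (γ : ℝ) (v : Fin d → Bool) (i : Fin d) (h : Bool → ℝ) :
    ∑ s, prodLaw γ v s * h (s i) = ∑ b, bitLaw γ (v i) b * h b := by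
  have h1 : ∀ s : Fin d → Bool, prodLaw γ v s * h (s i)
      = ∏ j, bitLaw γ (v j) (s j) * if j = i then h (s j) else 1 := fun s => by
    rw [prod_mul_distrib, prod_ite_eq' univ i]
    simp [prodLaw]
  rw [sum_congr rfl fun s _ => h1 s,
    ← Fintype.prod_sum fun j b => bitLaw γ (v j) b * if j = i then h b else 1]
  rw [prod_eq_single i]
  · simp
  · intro j _ hj
    simp only [hj, if_false, mul_one, sum_bitLaw]
  · simp

section FamilyBounds

variable {γ : ℝ} (hγ : 0 ≤ γ) (hγ1 : γ ≤ 1 / 16)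
include hγ hγ1

theorem prodLaw_pos (v s : Fin d → Bool) : 0 < prodLaw γ v s :=
  prod_pos fun _ _ => bitLaw_pos hγ hγ1 _ _

theorem prodLaw_flipAt (v s : Fin d → Bool) (i : Fin d) :
    prodLaw γ (flipAt v i) s = prodLaw γ v s * (1 + bitDev γ (v i) (s i)) := by
  have : ∀ j, bitLaw γ (flipAt v i j) (s j)
      = bitLaw γ (v j) (s j) * if j = i then 1 + bitDev γ (v j) (s j) else 1 := by
    intro j
    by_cases h : j = i
    · subst h
      simp [bitLaw_not hγ hγ1]
    · simp [h, flipAt_of_ne]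
  unfold prodLaw
  rw [prod_congr rfl fun j _ => this j, prod_mul_distrib, prod_ite_eq' univ i]
  simp

theorem infoBound_prodLaw (r : ℕ) (hγ0 : 0 < γ) :
    InfoBound r (prodLaw (d := d) γ) (64 * γ ^ 2 * min (d : ℝ) r) := by
  intro v W hW hW1
  have hw := prodLaw_pos hγ hγ1 v
  have hWle : ∀ s z, W s z ≤ 1 := fun s z =>
    (single_le_sum (fun z _ => hW s z) (mem_univ z)).trans_eq (hW1 s)
  have h1 : ∑ i, ∑ z, (msgLaw (prodLaw γ v) W z - msgLaw (prodLaw γ (flipAt v i)) W z) ^ 2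
        / msgLaw (prodLaw γ (flipAt v i)) W z
      ≤ 2 * ∑ i, ∑ z, (∑ s, prodLaw γ v s * W s z * bitDev γ (v i) (s i)) ^ 2
        / msgLaw (prodLaw γ v) W z := by
    rw [mul_sum]
    exact sum_le_sum fun i _ => chiSq_msgLaw_le hw hW (fun s => prodLaw_flipAt hγ hγ1 v s i)
      fun s => neg_half_le_bitDev hγ hγ1 _ _
  refine h1.trans ?_
  rw [mul_min_of_nonneg _ _ (by positivity)]
  refine le_min ?_ ?_
  · have h2 : ∀ i, ∑ z, (∑ s, prodLaw γ v s * W s z * bitDev γ (v i) (s i)) ^ 2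
        / msgLaw (prodLaw γ v) W z ≤ 25 / 4 * γ ^ 2 := by
      intro i
      refine (sum_sq_div_msgLaw_le hw hW hW1).trans ?_
      calc ∑ s, prodLaw γ v s * bitDev γ (v i) (s i) ^ 2
          ≤ ∑ s, prodLaw γ v s * (25 / 4 * γ ^ 2) := by
            refine sum_le_sum fun s _ => ?_
            gcongr
            exacts [(hw s).le, bitDev_sq_le hγ hγ1 _ _]
        _ = 25 / 4 * γ ^ 2 := by rw [← sum_mul, sum_prodLaw, one_mul]
    have h3 := sum_le_sum fun i (_ : i ∈ univ) => h2 i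
    simp only [sum_const, card_univ, Fintype.card_fin, nsmul_eq_mul] at h3
    have : 0 ≤ γ ^ 2 * d := by positivity
    linarith
  · have h2 := sum_sum_sq_div_msgLaw_le_log (φ := fun i s => bitDev γ (v i) (s i)) hw
      (sum_prodLaw γ v) hW hWle hW1 (c := 25 / 4 * γ ^ 2) (by positivity)
      (mgf_prod_le (fun i b => (bitLaw_pos hγ hγ1 _ _).le) (fun i => sum_bitLaw γ (v i))
        (fun i => sum_bitLaw_mul_bitDev hγ hγ1 _) fun i b => bitDev_sq_le hγ hγ1 _ _)
    have h3 : Real.log (Fintype.card (Msg r)) ≤ r := by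
      have h4 : Fintype.card (Msg r) = 2 ^ r := by simp
      rw [h4, Nat.cast_pow, Nat.cast_ofNat, Real.log_pow]
      exact mul_le_of_le_one_right (by positivity) (by linarith [Real.log_two_lt_d9])
    have h4 : 4 * (25 / 4 * γ ^ 2) * Real.log (Fintype.card (Msg r))
        ≤ 4 * (25 / 4 * γ ^ 2) * r := by gcongr
    have h5 : 0 ≤ γ ^ 2 * r := by positivity
    linarith

theorem coordLaw_pos (v : Fin d → Bool) (s : Fin d × Bool) : 0 < coordLaw γ v s := by
  have : 0 < d := s.1.pos
  exact div_pos (bitLaw_pos hγ hγ1 _ _) (by positivity)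

theorem coordLaw_flipAt (v : Fin d → Bool) (s : Fin d × Bool) (i : Fin d) :
    coordLaw γ (flipAt v i) s
      = coordLaw γ v s * (1 + if s.1 = i then bitDev γ (v i) s.2 else 0) := by
  unfold coordLaw
  by_cases h : s.1 = i
  · subst h
    simp only [flipAt_self, if_true, bitLaw_not hγ hγ1]
    ring
  · simp [h, flipAt_of_ne]

end FamilyBounds

theorem sum_coordLaw_mul (γ : ℝ) (v : Fin d → Bool) (i : Fin d) (h : Bool → ℝ) :
    ∑ s : Fin d × Bool, coordLaw γ v s * (if s.1 = i then h s.2 else 0)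
      = (∑ b, bitLaw γ (v i) b * h b) / d := by
  rw [Fintype.sum_prod_type, sum_eq_single i]
  · rw [sum_div]
    refine sum_congr rfl fun b _ => ?_
    simp only [coordLaw, if_true]
    ring
  · intro j _ hj
    simp [hj]
  · simp

theorem sum_coordLaw (hd : 0 < d) (γ : ℝ) (v : Fin d → Bool) : ∑ s, coordLaw γ v s = 1 := by
  have : (d : ℝ) ≠ 0 := by positivity
  simp only [coordLaw, Fintype.sum_prod_type, ← sum_div, sum_bitLaw]
  simp [this]

theorem infoBound_coordLaw {γ : ℝ} (hd : 0 < d) (hγ : 0 ≤ γ) (hγ1 : γ ≤ 1 / 16) (r : ℕ) :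
    InfoBound r (coordLaw (d := d) γ) (64 * γ ^ 2 * (min (2 ^ r) (d : ℝ) / d)) := by
  intro v W hW hW1
  have hd0 : (0 : ℝ) < d := by positivity
  have hw := coordLaw_pos hγ hγ1 v
  have hWle : ∀ s z, W s z ≤ 1 := fun s z =>
    (single_le_sum (fun z _ => hW s z) (mem_univ z)).trans_eq (hW1 s)
  set φ : Fin d → Fin d × Bool → ℝ := fun i s => if s.1 = i then bitDev γ (v i) s.2 else 0 with hφ
  have hvar : ∀ i, ∑ s, coordLaw γ v s * φ i s ^ 2 ≤ 25 / 4 * γ ^ 2 / d := by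
    intro i
    have h1 : ∀ s : Fin d × Bool, φ i s ^ 2 = if s.1 = i then bitDev γ (v i) s.2 ^ 2 else 0 := by
      intro s
      simp only [hφ]
      split_ifs <;> simp
    simp only [h1]
    rw [sum_coordLaw_mul γ v i fun b => bitDev γ (v i) b ^ 2]
    gcongr
    calc ∑ b, bitLaw γ (v i) b * bitDev γ (v i) b ^ 2
        ≤ ∑ b, bitLaw γ (v i) b * (25 / 4 * γ ^ 2) := by
          refine sum_le_sum fun b _ => ?_
          gcongr
          exacts [(bitLaw_pos hγ hγ1 _ _).le, bitDev_sq_le hγ hγ1 _ _]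
      _ = 25 / 4 * γ ^ 2 := by rw [← sum_mul, sum_bitLaw, one_mul]
  have h1 : ∑ i, ∑ z, (msgLaw (coordLaw γ v) W z - msgLaw (coordLaw γ (flipAt v i)) W z) ^ 2
        / msgLaw (coordLaw γ (flipAt v i)) W z
      ≤ 2 * ∑ i, ∑ z, (∑ s, coordLaw γ v s * W s z * φ i s) ^ 2 / msgLaw (coordLaw γ v) W z := by
    rw [mul_sum]
    refine sum_le_sum fun i _ => chiSq_msgLaw_le hw hW (fun s => coordLaw_flipAt hγ hγ1 v s i)
      fun s => ?_
    simp only [hφ]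
    split_ifs
    exacts [neg_half_le_bitDev hγ hγ1 _ _, by norm_num]
  refine h1.trans ?_
  rw [← min_div_div_right hd0.le, mul_min_of_nonneg _ _ (by positivity)]
  refine le_min ?_ ?_
  · have h2 := sum_sum_sq_div_msgLaw_le_card (φ := φ) hw hW hWle Prod.fst
      (fun i s hs => by simp [hφ, hs]) (c := 25 / 4 * γ ^ 2 / d) (by positivity) hvar
    have h4 : (Fintype.card (Msg r) : ℝ) = 2 ^ r := by simp
    rw [h4] at h2
    have h5 : (2 : ℝ) ^ r * (25 / 4 * γ ^ 2 / d) = 25 / 4 * (γ ^ 2 * (2 ^ r / d)) := by ring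
    have h6 : 0 ≤ γ ^ 2 * ((2 : ℝ) ^ r / d) := by positivity
    linarith
  · have h2 := sum_le_sum fun i (_ : i ∈ univ) =>
      (sum_sq_div_msgLaw_le (φ := φ i) hw hW hW1).trans (hvar i)
    simp only [sum_const, card_univ, Fintype.card_fin, nsmul_eq_mul] at h2
    have h3 : (d : ℝ) * (25 / 4 * γ ^ 2 / d) = 25 / 4 * γ ^ 2 := by field_simp
    rw [div_self hd0.ne']
    have : 0 ≤ γ ^ 2 := by positivity
    linarith

/-! ### Transcripts of protocols with a finitely supported oracle -/

/-- The measure with mass `w s` at the point `G s`, for `s` in a finite index type. -/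
noncomputable def atomicMeasure {S : Type*} [Fintype S] {d : ℕ} (w : S → ℝ) (G : S → E d) :
    Measure (E d) :=
  ∑ s, ENNReal.ofReal (w s) • Measure.dirac (G s)

section Atomic

variable {S : Type*} [Fintype S] {d : ℕ} {w : S → ℝ}

theorem lintegral_atomicMeasure (w : S → ℝ) (G : S → E d) (f : E d → ℝ≥0∞) :
    ∫⁻ g, f g ∂atomicMeasure w G = ∑ s, ENNReal.ofReal (w s) * f (G s) := by
  simp [atomicMeasure, lintegral_finsetSum_measure]

theorem isProbabilityMeasure_atomicMeasure (hw : ∀ s, 0 < w s) (hw1 : ∑ s, w s = 1)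
    (G : S → E d) : IsProbabilityMeasure (atomicMeasure w G) := by
  refine ⟨?_⟩
  rw [← lintegral_one, lintegral_atomicMeasure]
  simp only [mul_one]
  rw [← ENNReal.ofReal_sum_of_nonneg fun s _ => (hw s).le, hw1, ENNReal.ofReal_one]

theorem integral_atomicMeasure (hw : ∀ s, 0 < w s) (G : S → E d) :
    ∫ g, g ∂atomicMeasure w G = ∑ s, w s • G s := by
  unfold atomicMeasure
  rw [integral_finsetSum_measure fun s _ =>
    (integrable_dirac (by simp)).smul_measure ENNReal.ofReal_ne_top]
  refine sum_congr rfl fun s _ => ?_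
  rw [integral_smul_measure, integral_dirac, ENNReal.toReal_ofReal (hw s).le]

theorem ae_atomicMeasure {G : S → E d} {p : E d → Prop} (h : ∀ s, p (G s)) :
    ∀ᵐ g ∂atomicMeasure w G, p g := by
  unfold atomicMeasure
  rw [← Measure.sum_fintype, Measure.ae_sum_iff]
  exact fun s => Measure.ae_smul_measure ((ae_dirac_eq (G s)).symm ▸ h s) _

end Atomic

section Transcript

variable {d T r : ℕ} {X : Set (E d)} {Ω : Type} [MeasurableSpace Ω]
  {S : Type*} [Fintype S]

theorem step_isMarkovKernel {O : Oracle X} (hO : IsMarkovKernel O) (π : Algorithm X T Ω (Msg r))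
    (σ : ChannelStrategy (Msg r) (comChannels d r) Ω) (t : ℕ) :
    IsMarkovKernel (step O π σ t) := by
  have := σ.isMarkov t
  unfold step
  infer_instance

theorem transcript_isMarkovKernel {O : Oracle X} (hO : IsMarkovKernel O)
    (π : Algorithm X T Ω (Msg r)) (σ : ChannelStrategy (Msg r) (comChannels d r) Ω) (t : ℕ) :
    IsMarkovKernel (transcript O π σ t) := by
  induction t with
  | zero =>
    unfold transcript
    infer_instance
  | succ t ih =>
    have := step_isMarkovKernel hO π σ t
    unfold transcript
    exact Kernel.IsMarkovKernel.map _ Measurable.of_discrete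

theorem transcript_real_snoc {O : Oracle X} (hO : IsMarkovKernel O)
    (π : Algorithm X T Ω (Msg r)) (σ : ChannelStrategy (Msg r) (comChannels d r) Ω) (t : ℕ) (ω : Ω)
    (y : Fin t → Msg r) (z : Msg r) :
    (transcript O π σ (t + 1) ω).real {Fin.snoc y z}
      = (transcript O π σ t ω).real {y} * (step O π σ t (ω, y)).real {z} := by
  have := step_isMarkovKernel hO π σ t
  have := transcript_isMarkovKernel hO π σ t
  have hpre : (fun z : (Fin t → Msg r) × Msg r => (Fin.snoc z.1 z.2 : Fin (t + 1) → Msg r)) ⁻¹'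
      {Fin.snoc y z} = {y} ×ˢ {z} := by
    ext ⟨y', z'⟩
    simp [Fin.snoc_inj]
  unfold Measure.real
  rw [transcript, Kernel.map_apply' _ Measurable.of_discrete _ (measurableSet_singleton _), hpre,
    Kernel.compProd_apply_prod (measurableSet_singleton _) (measurableSet_singleton _),
    lintegral_singleton, ENNReal.toReal_mul, mul_comm]

/-- With an oracle that ignores the query and has finitely many atoms, the law of the next message
is that of a message about the index of the atom. -/
theorem step_real_singleton {w : S → ℝ} {G : S → E d} (hw : ∀ s, 0 < w s) (hw1 : ∑ s, w s = 1)
    (π : Algorithm X T Ω (Msg r)) (σ : ChannelStrategy (Msg r) (comChannels d r) Ω) (t : ℕ)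
    (h : Ω × (Fin t → Msg r)) (z : Msg r) :
    (step (Kernel.const X (atomicMeasure w G)) π σ t h).real {z}
      = msgLaw w (fun s z => (σ.channel t (h, G s)).real {z}) z := by
  have := σ.isMarkov t
  have := isProbabilityMeasure_atomicMeasure hw hw1 G
  unfold Measure.real step
  rw [Kernel.comp_apply' _ _ _ (measurableSet_singleton _),
    Kernel.lintegral_id_prod (Kernel.measurable_coe _ (measurableSet_singleton _)),
    Kernel.comap_apply, Kernel.const_apply, lintegral_atomicMeasure,
    ENNReal.toReal_sum fun s _ => ENNReal.mul_ne_top ENNReal.ofReal_ne_top (measure_ne_top _ _)]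
  refine sum_congr rfl fun s _ => ?_
  rw [ENNReal.toReal_mul, ENNReal.toReal_ofReal (hw s).le]

theorem sum_measureReal_singleton_eq_one {α : Type*} [Fintype α] [MeasurableSpace α]
    [MeasurableSingletonClass α] (μ : Measure α) [IsProbabilityMeasure μ] :
    ∑ a, μ.real {a} = 1 := by
  rw [sum_measureReal_singleton]
  simp

variable {w : (Fin d → Bool) → S → ℝ} {G : S → E d} (hw : ∀ v s, 0 < w v s)
  (hw1 : ∀ v, ∑ s, w v s = 1) (π : Algorithm X T Ω (Msg r))
  (σ : ChannelStrategy (Msg r) (comChannels d r) Ω)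
include hw hw1

/-- All the transcript laws have the same support. -/
theorem transcript_real_eq_zero_of (v v' : Fin d → Bool) (ω : Ω) (t : ℕ) (y : Fin t → Msg r)
    (h : (transcript (Kernel.const X (atomicMeasure (w v') G)) π σ t ω).real {y} = 0) :
    (transcript (Kernel.const X (atomicMeasure (w v) G)) π σ t ω).real {y} = 0 := by
  have hO : ∀ v, IsMarkovKernel (Kernel.const X (atomicMeasure (w v) G)) := fun v =>
    have := isProbabilityMeasure_atomicMeasure (hw v) (hw1 v) G
    inferInstance
  induction t with
  | zero => exact h
  | succ t ih =>
    rw [← Fin.snoc_init_self y] at h ⊢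
    rw [transcript_real_snoc (hO _), step_real_singleton (hw _) (hw1 _), mul_eq_zero,
      msgLaw_eq_zero_iff (hw _) fun _ _ => measureReal_nonneg] at h ⊢
    exact h.imp_left (ih _)

/-- The chain rule: `t` rounds provide at most `t` times the information of a single round. -/
theorem sum_relEntropy_transcript_le {K : ℝ} (hK : InfoBound r w K) (v : Fin d → Bool) (ω : Ω)
    (t : ℕ) :
    ∑ i, relEntropy
        (fun y => (transcript (Kernel.const X (atomicMeasure (w v) G)) π σ t ω).real {y})
        (fun y => (transcript (Kernel.const X (atomicMeasure (w (flipAt v i)) G)) π σ t ω).real {y})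
      ≤ t * K := by
  have hO : ∀ v, IsMarkovKernel (Kernel.const X (atomicMeasure (w v) G)) := fun v =>
    have := isProbabilityMeasure_atomicMeasure (hw v) (hw1 v) G
    inferInstance
  induction t with
  | zero =>
    refine (sum_nonpos fun i _ => ?_).trans_eq (by simp)
    refine le_of_eq (sum_eq_zero fun y _ => ?_)
    -- The empty transcript has the same law for every oracle.
    show (transcript (Kernel.const X (atomicMeasure (w v) G)) π σ 0 ω).real {y} * Real.log
      ((transcript (Kernel.const X (atomicMeasure (w v) G)) π σ 0 ω).real {y} /
        (transcript (Kernel.const X (atomicMeasure (w v) G)) π σ 0 ω).real {y}) = 0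
    by_cases h : (transcript (Kernel.const X (atomicMeasure (w v) G)) π σ 0 ω).real {y} = 0
    · simp [h]
    · rw [div_self h, Real.log_one, mul_zero]
  | succ t ih =>
    have := σ.isMarkov t
    have := transcript_isMarkovKernel (hO v) π σ t
    set W : (Fin t → Msg r) → S → Msg r → ℝ := fun y s z =>
      (σ.channel t ((ω, y), G s)).real {z} with hW
    have hW0 : ∀ y s z, 0 ≤ W y s z := fun _ _ _ => measureReal_nonneg
    have hW1 : ∀ y s, ∑ z, W y s z = 1 := fun y s => sum_measureReal_singleton_eq_one _
    have hrec : ∀ v (y : Fin t → Msg r) z,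
        (transcript (Kernel.const X (atomicMeasure (w v) G)) π σ (t + 1) ω).real {Fin.snoc y z}
          = (transcript (Kernel.const X (atomicMeasure (w v) G)) π σ t ω).real {y}
            * msgLaw (w v) (W y) z := fun v y z => by
      rw [transcript_real_snoc (hO v), step_real_singleton (hw v) (hw1 v)]
    have hsupp : ∀ i y z, msgLaw (w (flipAt v i)) (W y) z = 0 → msgLaw (w v) (W y) z = 0 :=
      fun i y z h => by
        rw [msgLaw_eq_zero_iff (hw _) (hW0 y)] at h ⊢
        exact h
    have hstep : ∀ y, ∑ i, relEntropy (msgLaw (w v) (W y)) (msgLaw (w (flipAt v i)) (W y)) ≤ K := by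
      intro y
      refine le_trans (sum_le_sum fun i _ => ?_) (hK v (W y) (hW0 y) (hW1 y))
      exact relEntropy_le_sum_sq_div (msgLaw_nonneg (hw _) (hW0 y)) (msgLaw_nonneg (hw _) (hW0 y))
        (hsupp i y) ((sum_msgLaw (hw1 _) (hW1 y)).trans (sum_msgLaw (hw1 _) (hW1 y)).symm)
    rw [sum_congr rfl fun i _ => relEntropy_snoc (hrec v) (hrec (flipAt v i))
      (fun y h => transcript_real_eq_zero_of hw hw1 π σ v (flipAt v i) ω t y h) (hsupp i)
      fun y => sum_msgLaw (hw1 _) (hW1 y), sum_add_distrib]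
    have hnew : ∑ i, ∑ y : Fin t → Msg r,
        (transcript (Kernel.const X (atomicMeasure (w v) G)) π σ t ω).real {y}
          * relEntropy (msgLaw (w v) (W y)) (msgLaw (w (flipAt v i)) (W y)) ≤ K := by
      rw [sum_comm]
      calc _ ≤ ∑ y : Fin t → Msg r,
            (transcript (Kernel.const X (atomicMeasure (w v) G)) π σ t ω).real {y} * K := by
            refine sum_le_sum fun y _ => ?_
            rw [← mul_sum]
            exact mul_le_mul_of_nonneg_left (hstep y) measureReal_nonneg
        _ = K := by rw [← sum_mul, sum_measureReal_singleton_eq_one, one_mul]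
    push_cast
    linarith

end Transcript

/-! ### The linear minimization problem over a cube -/

/-- The cube of all points whose coordinates have absolute value at most `a`. -/
def cube (d : ℕ) (a : ℝ) : Set (E d) := {x | ∀ i, |x i| ≤ a}

theorem cube_eq_Icc (d : ℕ) (a : ℝ) : cube d a = Set.Icc (fun _ => -a) fun _ => a := by
  ext x
  simp [cube, abs_le, Pi.le_def, forall_and]

/-- The linear objective whose minimum over a cube is attained at the vertex with signs `-v`. -/
def signedSum {d : ℕ} (C : ℝ) (v : Fin d → Bool) (x : E d) : ℝ := C * ∑ i, sgn (v i) * x i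

theorem iInf_signedSum_le {d : ℕ} {C a : ℝ} (hC : 0 ≤ C) (ha : 0 ≤ a) (v : Fin d → Bool) :
    ⨅ x : cube d a, signedSum C v x ≤ -(C * ∑ _i : Fin d, a) := by
  have hbdd : BddBelow (Set.range fun x : cube d a => signedSum C v x) := by
    refine ⟨-(C * ∑ _i : Fin d, a), ?_⟩
    rintro _ ⟨x, rfl⟩
    simp only [signedSum]
    rw [← mul_neg, ← sum_neg_distrib]
    gcongr with i _
    have : |sgn (v i) * x.1 i| ≤ a := by
      rw [abs_mul, abs_sgn, one_mul]
      exact x.2 i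
    exact (abs_le.1 this).1
  have hx : (fun i => -(a * sgn (v i))) ∈ cube d a := fun i => by
    rw [abs_neg, abs_mul, abs_sgn, mul_one, abs_of_nonneg ha]
  refine (ciInf_le hbdd ⟨_, hx⟩).trans_eq ?_
  simp only [signedSum]
  rw [← mul_neg, ← sum_neg_distrib]
  congr 1
  refine sum_congr rfl fun i _ => ?_
  linear_combination (-a) * sgn_mul_self (v i)

/-- A family of finitely supported gradient laws with means `C • v`, about which messages reveal
little, forces a large optimization error over the cube. -/
theorem le_minmaxError_cube {d r T : ℕ} {p : ℝ≥0∞} {B C a K : ℝ} {S : Type*} [Fintype S]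
    {w : (Fin d → Bool) → S → ℝ} {G : S → E d} (hw : ∀ v s, 0 < w v s)
    (hw1 : ∀ v, ∑ s, w v s = 1) (hmean : ∀ v i, ∑ s, w v s * G s i = C * sgn (v i))
    (hG : ∀ s, ellNorm (ENNReal.conjExponent p) (G s) ^ 2 ≤ B ^ 2) (hC : 0 ≤ C) (ha : 0 ≤ a)
    (hK : InfoBound r w K) (hTK : T * K ≤ d / 16) :
    ENNReal.ofReal (C * (3 / 4 * a * d))
      ≤ minmaxError (cube d a) (convexLipschitzFamily (cube d a) p B) T (comChannels d r) := by
  unfold minmaxError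
  refine le_iInf fun Ω => le_iInf fun _ => le_iInf fun μ => le_iInf fun _ => le_iInf fun π =>
    le_iInf fun σ => ?_
  set O : (Fin d → Bool) → Oracle (cube d a) := fun v =>
    Kernel.const (cube d a) (atomicMeasure (w v) G) with hOdef
  have hO : ∀ v, IsMarkovKernel (O v) := fun v =>
    have := isProbabilityMeasure_atomicMeasure (hw v) (hw1 v) G
    inferInstanceAs (IsMarkovKernel (Kernel.const _ _))
  have hsubgrad : ∀ v (x y : E d), signedSum C v x
      + dotProduct (∑ s, w v s • G s) (y - x) = signedSum C v y := by
    intro v x y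
    have h1 : ∑ s, w v s • G s = fun i => C * sgn (v i) := by
      ext i
      simp [Finset.sum_apply, hmean]
    rw [h1]
    simp only [signedSum, dotProduct, mul_sum, ← sum_add_distrib, Pi.sub_apply]
    exact sum_congr rfl fun i _ => by ring
  have hmem : ∀ v, (signedSum C v, O v) ∈ convexLipschitzFamily (cube d a) p B := by
    intro v
    refine ⟨⟨?_, fun x _ y _ s t _ _ _ => le_of_eq ?_⟩, hO v, fun x => ?_, fun x => ?_⟩
    · rw [cube_eq_Icc]
      exact convex_Icc _ _
    · simp only [signedSum, Pi.add_apply, Pi.smul_apply, smul_eq_mul, mul_sum, ← sum_add_distrib]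
      exact sum_congr rfl fun i _ => by ring
    · simp only [hOdef, Kernel.const_apply]
      rw [integral_atomicMeasure (hw v)]
      exact fun y _ => (hsubgrad v x y).le
    · simp only [hOdef, Kernel.const_apply]
      exact ae_atomicMeasure hG
  set sup := ⨆ fO ∈ convexLipschitzFamily (cube d a) p B, optError fO.1 fO.2 μ π σ with hsup
  have hle : ∀ v, optError (signedSum C v) (O v) μ π σ ≤ sup := fun v =>
    le_iSup₂_of_le (f := fun (fO : (E d → ℝ) × Oracle (cube d a))
      (_ : fO ∈ convexLipschitzFamily (cube d a) p B) => optError fO.1 fO.2 μ π σ) _ (hmem v) le_rfl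
  -- The excess of the objective over its minimum, with the signs of `v`.
  set h : (Fin d → Bool) → Ω × (Fin T → Msg r) → ℝ := fun v z =>
    C * ∑ i, (a + sgn (v i) * (π.output z).1 i) with hh
  have hcube : ∀ z i, |(π.output z).1 i| ≤ a := fun z i => (π.output z).2 i
  have hh0 : ∀ v z, 0 ≤ h v z := by
    refine fun v z => mul_nonneg hC (sum_nonneg fun i _ => ?_)
    have : |sgn (v i) * (π.output z).1 i| ≤ a := by
      rw [abs_mul, abs_sgn, one_mul]
      exact hcube z i
    linarith [(abs_le.1 this).1]
  have hhm : ∀ v, Measurable (h v) := by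
    intro v
    have hout : Measurable fun z => (π.output z).1 :=
      measurable_subtype_coe.comp π.measurable_output
    have hi : ∀ i, Measurable fun z => (π.output z).1 i := fun i =>
      (measurable_pi_apply i).comp hout
    simp only [hh]
    fun_prop
  have herr : ∀ v, ∫⁻ ω, ∫⁻ y, ENNReal.ofReal (h v (ω, y)) ∂(transcript (O v) π σ T ω) ∂μ
      ≤ optError (signedSum C v) (O v) μ π σ := by
    intro v
    have := transcript_isMarkovKernel (hO v) π σ T
    rw [← Measure.lintegral_compProd (hhm v).ennreal_ofReal]
    refine lintegral_mono fun z => ENNReal.ofReal_le_ofReal ?_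
    have h1 := iInf_signedSum_le hC ha v
    have h2 : h v z = signedSum C v (π.output z) + C * ∑ _i : Fin d, a := by
      simp only [hh, signedSum, sum_add_distrib]
      ring
    linarith
  have hpoint : ∀ ω, ENNReal.ofReal (2 ^ d * (C * (3 / 4 * a * d)))
      ≤ ∑ v, ∫⁻ y, ENNReal.ofReal (h v (ω, y)) ∂(transcript (O v) π σ T ω) := by
    intro ω
    have hmk := fun v => transcript_isMarkovKernel (hO v) π σ T
    have h1 : ∀ v, ∫⁻ y, ENNReal.ofReal (h v (ω, y)) ∂(transcript (O v) π σ T ω)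
        = ENNReal.ofReal (∑ y, (transcript (O v) π σ T ω).real {y} * h v (ω, y)) := by
      intro v
      rw [lintegral_fintype, ENNReal.ofReal_sum_of_nonneg fun y _ =>
        mul_nonneg measureReal_nonneg (hh0 v _)]
      refine sum_congr rfl fun y _ => ?_
      rw [ENNReal.ofReal_mul measureReal_nonneg, ofReal_measureReal, mul_comm]
    rw [sum_congr rfl fun v _ => h1 v, ← ENNReal.ofReal_sum_of_nonneg fun v _ =>
      sum_nonneg fun y _ => mul_nonneg measureReal_nonneg (hh0 v _)]
    refine ENNReal.ofReal_le_ofReal ?_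
    have h2 := assouad (P := fun v y => (transcript (O v) π σ T ω).real {y})
      (x := fun y => (π.output (ω, y)).1) (a := a) (fun v y => measureReal_nonneg)
      (fun v => sum_measureReal_singleton_eq_one _)
      (fun v i y => transcript_real_eq_zero_of hw hw1 π σ v (flipAt v i) ω T y)
      (fun y i => hcube _ i)
      (fun v => (sum_relEntropy_transcript_le hw hw1 π σ hK v ω T).trans hTK)
    calc _ = C * (2 ^ d * (3 / 4 * a * d)) := by ring
      _ ≤ _ := mul_le_mul_of_nonneg_left h2 hC
      _ = _ := by
        simp only [mul_sum, hh]
        refine sum_congr rfl fun v _ => sum_congr rfl fun y _ => sum_congr rfl fun i _ => ?_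
        ring
  have hall : ENNReal.ofReal (2 ^ d * (C * (3 / 4 * a * d))) ≤ 2 ^ d * sup := by
    calc _ = ∫⁻ _ω, ENNReal.ofReal (2 ^ d * (C * (3 / 4 * a * d))) ∂μ := by simp
      _ ≤ ∫⁻ ω, ∑ v, ∫⁻ y, ENNReal.ofReal (h v (ω, y)) ∂(transcript (O v) π σ T ω) ∂μ :=
        lintegral_mono hpoint
      _ = ∑ v, ∫⁻ ω, ∫⁻ y, ENNReal.ofReal (h v (ω, y)) ∂(transcript (O v) π σ T ω) ∂μ := by
        refine lintegral_finsetSum _ fun v _ => ?_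
        have := transcript_isMarkovKernel (hO v) π σ T
        exact Measurable.lintegral_kernel_prod_right (f := fun ω y => ENNReal.ofReal (h v (ω, y)))
          (hhm v).ennreal_ofReal
      _ ≤ ∑ _v : Fin d → Bool, sup := sum_le_sum fun v _ => (herr v).trans (hle v)
      _ = 2 ^ d * sup := by simp
  rw [ENNReal.ofReal_mul (by positivity), ENNReal.ofReal_pow (by norm_num)] at hall
  simp only [ENNReal.ofReal_ofNat] at hall
  exact (ENNReal.mul_le_mul_iff_right (by simp) (by simp)).1 hall

/-! ### Norms and the choice of parameters -/

theorem ellNorm_le {d : ℕ} {p : ℝ≥0∞} (hp : 1 ≤ p) {x : E d} {c : ℝ} (hc : 0 ≤ c)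
    (hx : ∀ i, |x i| ≤ c) : ellNorm p x ≤ (d : ℝ) ^ (p⁻¹).toReal * c := by
  have : Fact (1 ≤ p) := ⟨hp⟩
  have h := (PiLp.antilipschitzWith_ofLp p fun _ : Fin d => ℝ).le_mul_norm (map_zero
    (WithLp.linearEquiv p ℝ (Fin d → ℝ))) (WithLp.toLp p x)
  unfold ellNorm
  refine h.trans ?_
  simp only [Fintype.card_fin, one_div, NNReal.coe_rpow, NNReal.coe_natCast]
  gcongr
  exact (pi_norm_le_iff_of_nonneg hc).2 hx

theorem ellNorm_single {d : ℕ} {p : ℝ≥0∞} (hp : 1 ≤ p) (i : Fin d) (b : ℝ) :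
    ellNorm p (Pi.single i b) = |b| := by
  have : Fact (1 ≤ p) := ⟨hp⟩
  exact PiLp.norm_single p (fun _ : Fin d => ℝ) i b

theorem ellNorm_nonneg {d : ℕ} {p : ℝ≥0∞} (hp : 1 ≤ p) (x : E d) : 0 ≤ ellNorm p x := by
  have : Fact (1 ≤ p) := ⟨hp⟩
  exact norm_nonneg _

theorem cube_mem_domains {d : ℕ} {p : ℝ≥0∞} {D : ℝ} (hd : 0 < d) (hp : 1 ≤ p) (hD : 0 < D) :
    cube d (D / (2 * (d : ℝ) ^ (p⁻¹).toReal)) ∈ domains d p D := by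
  have hpos : 0 < (d : ℝ) ^ (p⁻¹).toReal := by positivity
  have ha : 0 < D / (2 * (d : ℝ) ^ (p⁻¹).toReal) := by positivity
  refine ⟨⟨0, fun i => by simpa using ha.le⟩, ?_, ?_, fun x hx y hy => ?_⟩
  · rw [cube_eq_Icc]
    exact isClosed_Icc
  · rw [cube_eq_Icc]
    exact convex_Icc _ _
  · refine (ellNorm_le hp (c := D / (d : ℝ) ^ (p⁻¹).toReal) (by positivity) fun i => ?_).trans_eq ?_
    · calc |(x - y) i| ≤ |x i| + |y i| := abs_sub _ _
        _ ≤ _ := add_le_add (hx i) (hy i)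
        _ = _ := by
          field_simp
          norm_num
    · field_simp

theorem toReal_inv_conjExponent {p : ℝ≥0∞} (hp : 1 ≤ p) :
    ((ENNReal.conjExponent p)⁻¹).toReal = 1 - (p⁻¹).toReal := by
  have h := (ENNReal.HolderConjugate.conjExponent hp).inv_add_inv_eq_one
  have h1 : p⁻¹ ≠ ∞ := by simpa using (zero_lt_one.trans_le hp).ne'
  have h2 : (ENNReal.conjExponent p)⁻¹ ≠ ∞ := fun h0 => by simp [h0] at h
  have h3 := congrArg ENNReal.toReal h
  rw [ENNReal.toReal_add h1 h2, ENNReal.toReal_one] at h3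
  linarith

theorem one_div_twelve_mul_sqrt_le : 1 / (12 * √58) ≤ (3 / 256 : ℝ) := by
  have h : (7.2 : ℝ) ≤ √58 := Real.le_sqrt_of_sq_le (by norm_num)
  rw [div_le_div_iff₀ (by positivity) (by norm_num)]
  linarith

section Bounds

variable {d r T : ℕ} {p : ℝ≥0∞} {B D : ℝ}

/-- The lower bound from gradients that reveal a single, uniformly random coordinate. -/
theorem le_minmaxError_coord (hd : 1 ≤ d) (hB : 0 < B) (hD : 0 < D)
    (hT0 : 0 < T) (hT : (d : ℝ) ^ 2 ≤ 4 * (T * min ((2 : ℝ) ^ r) d)) :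
    ENNReal.ofReal ((1 / (12 * √58)) * D * B * (d : ℝ) ^ (1 / 2 - (p⁻¹).toReal : ℝ) / √(T : ℝ)
          * √((d : ℝ) / min (d : ℝ) ((2 : ℝ) ^ r)))
      ≤ minmaxError (cube d (D / (2 * (d : ℝ) ^ (p⁻¹).toReal)))
          (convexLipschitzFamily (cube d (D / (2 * (d : ℝ) ^ (p⁻¹).toReal))) p B) T
          (comChannels d r) := by
  have hd0 : (0 : ℝ) < d := by positivity
  have hT0' : (0 : ℝ) < T := by positivity
  rw [min_comm]
  set m : ℝ := min ((2 : ℝ) ^ r) d with hm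
  have hm0 : 0 < m := lt_min (by positivity) hd0
  have hq : 1 ≤ ENNReal.conjExponent p := by simp [ENNReal.conjExponent]
  have hpow : 0 < (d : ℝ) ^ (p⁻¹).toReal := by positivity
  -- The correlation for which the information bound of `T` rounds is exactly `d / 16`.
  set γ : ℝ := d / (32 * √(T * m)) with hγ
  have hs0 : 0 < √(T * m) := Real.sqrt_pos.2 (by positivity)
  have hssq : √(T * m) ^ 2 = T * m := Real.sq_sqrt (by positivity)
  have hγ0 : 0 ≤ γ := by positivity
  have hγ1 : γ ≤ 1 / 16 := by
    have h1 : (d : ℝ) ≤ 2 * √(T * m) := abs_le_of_sq_le_sq' (by nlinarith) (by positivity) |>.2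
    rw [hγ, div_le_div_iff₀ (by positivity) (by norm_num)]
    linarith
  have hmain := le_minmaxError_cube (d := d) (T := T) (p := p) (B := B)
    (C := B * γ / d) (a := D / (2 * (d : ℝ) ^ (p⁻¹).toReal))
    (w := coordLaw γ) (G := fun s => Pi.single s.1 (B * sgn s.2)) (coordLaw_pos hγ0 hγ1)
    (sum_coordLaw hd γ) ?_ ?_ (by positivity) (by positivity)
    (infoBound_coordLaw hd hγ0 hγ1 r) ?_
  · refine (ENNReal.ofReal_le_ofReal ?_).trans hmain
    have h1 : (d : ℝ) ^ (1 / 2 - (p⁻¹).toReal : ℝ) = √d / (d : ℝ) ^ (p⁻¹).toReal := by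
      rw [Real.rpow_sub hd0, Real.sqrt_eq_rpow]
    have h2 : √d * √d = (d : ℝ) := Real.mul_self_sqrt hd0.le
    rw [h1, Real.sqrt_div hd0.le]
    calc _ = 1 / (12 * √58) * (D * B * (√d * √d) / ((d : ℝ) ^ (p⁻¹).toReal * (√T * √m))) := by
          ring
      _ ≤ 3 / 256 * (D * B * (√d * √d) / ((d : ℝ) ^ (p⁻¹).toReal * (√T * √m))) := by
          exact mul_le_mul_of_nonneg_right one_div_twelve_mul_sqrt_le (by positivity)
      _ = _ := by
          rw [h2, ← Real.sqrt_mul hT0'.le, hγ]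
          field_simp
          norm_num
  · intro v i
    have h1 : ∀ s : Fin d × Bool, coordLaw γ v s * (Pi.single s.1 (B * sgn s.2) : E d) i
        = coordLaw γ v s * (if s.1 = i then B * sgn s.2 else 0) := fun s => by
      rw [Pi.single_apply]
      simp only [eq_comm]
    rw [sum_congr rfl fun s _ => h1 s, sum_coordLaw_mul γ v i fun b => B * sgn b]
    simp only [mul_left_comm _ B, ← mul_sum, sum_bitLaw_mul_sgn]
    ring
  · intro s
    rw [ellNorm_single hq, abs_mul, abs_sgn, mul_one, abs_of_pos hB]
  · rw [hγ, div_pow, mul_pow, hssq, ← hm]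
    apply le_of_eq
    field_simp
    norm_num

/-- The lower bound from gradients that reveal all coordinates at once. -/
theorem le_minmaxError_prod (hd : 1 ≤ d) (hr : 1 ≤ r) (hp : 1 ≤ p) (hB : 0 < B) (hD : 0 < D)
    (hT0 : 0 < T) (hT : (d : ℝ) ≤ 4 * T) :
    ENNReal.ofReal ((1 / (12 * √58)) * D * B / √(T : ℝ) * √((d : ℝ) / min (d : ℝ) (r : ℝ)))
      ≤ minmaxError (cube d (D / (2 * (d : ℝ) ^ (p⁻¹).toReal)))
          (convexLipschitzFamily (cube d (D / (2 * (d : ℝ) ^ (p⁻¹).toReal))) p B) T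
          (comChannels d r) := by
  have hd0 : (0 : ℝ) < d := by positivity
  have hT0' : (0 : ℝ) < T := by positivity
  set m : ℝ := min (d : ℝ) r with hm
  have hm1 : 1 ≤ m := le_min (by exact_mod_cast hd) (by exact_mod_cast hr)
  have hm0 : 0 < m := by linarith
  have hq : 1 ≤ ENNReal.conjExponent p := by simp [ENNReal.conjExponent]
  have hpow : 0 < (d : ℝ) ^ (p⁻¹).toReal := by positivity
  have hqpow : (d : ℝ) ^ ((ENNReal.conjExponent p)⁻¹).toReal = d / (d : ℝ) ^ (p⁻¹).toReal := by
    rw [toReal_inv_conjExponent hp, Real.rpow_sub hd0, Real.rpow_one]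
  set R : ℝ := (d : ℝ) ^ (p⁻¹).toReal with hR
  -- The correlation for which the information bound of `T` rounds is exactly `d / 16`.
  set γ : ℝ := √d / (32 * √(T * m)) with hγ
  have hsd0 : 0 < √(d : ℝ) := Real.sqrt_pos.2 hd0
  have hsdsq : √(d : ℝ) ^ 2 = d := Real.sq_sqrt hd0.le
  have hs0 : 0 < √(T * m) := Real.sqrt_pos.2 (by positivity)
  have hssq : √(T * m) ^ 2 = T * m := Real.sq_sqrt (by positivity)
  have hγ0 : 0 < γ := by positivity
  have hγ1 : γ ≤ 1 / 16 := by
    have h1 : √(d : ℝ) ≤ 2 * √(T * m) :=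
      abs_le_of_sq_le_sq' (by nlinarith) (by positivity) |>.2
    rw [hγ, div_le_div_iff₀ (by positivity) (by norm_num)]
    linarith
  have hmain := le_minmaxError_cube (d := d) (T := T) (p := p) (B := B)
    (C := B * R / d * γ) (a := D / (2 * R))
    (w := prodLaw γ) (G := fun s i => B * R / d * sgn (s i)) (prodLaw_pos hγ0.le hγ1)
    (sum_prodLaw γ) ?_ ?_ (by positivity) (by positivity)
    (infoBound_prodLaw hγ0.le hγ1 r hγ0) ?_
  · refine (ENNReal.ofReal_le_ofReal ?_).trans hmain
    rw [Real.sqrt_div hd0.le]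
    calc _ = 1 / (12 * √58) * (D * B * √d / (√T * √m)) := by ring
      _ ≤ 3 / 256 * (D * B * √d / (√T * √m)) := by
          exact mul_le_mul_of_nonneg_right one_div_twelve_mul_sqrt_le (by positivity)
      _ = _ := by
          rw [← Real.sqrt_mul hT0'.le, hγ]
          field_simp
          norm_num
  · intro v i
    rw [sum_prodLaw_mul γ v i fun b => B * R / d * sgn b]
    simp only [mul_left_comm _ (B * R / d), ← mul_sum, sum_bitLaw_mul_sgn]
    ring
  · intro s
    have h1 := ellNorm_le hq (x := fun i => B * R / d * sgn (s i)) (c := B * R / d)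
      (by positivity) fun i => by
        rw [abs_mul, abs_sgn, mul_one, abs_of_nonneg (by positivity)]
    have h2 : (d : ℝ) / R * (B * R / d) = B := by field_simp
    rw [hqpow, h2] at h1
    exact pow_le_pow_left₀ (ellNorm_nonneg hq _) h1 2
  · rw [hγ, div_pow, mul_pow, hssq, hsdsq, ← hm]
    apply le_of_eq
    field_simp
    norm_num

end Bounds

end InfoOpt

theorem theoremt (d r T : ℕ) (p : ℝ≥0∞) (B D : ℝ) (hd : 1 ≤ d) (hr : 1 ≤ r) (hp : 2 < p)
    (hB : 0 < B) (hD : 0 < D)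
    (hT : (1 / 4 : ℝ) * ((d : ℝ) ^ 2 / min ((2 : ℝ) ^ r) (d : ℝ)) ≤ (T : ℝ)) :
    ENNReal.ofReal (max
        ((1 / (12 * √58)) * D * B * (d : ℝ) ^ (1 / 2 - (p⁻¹).toReal : ℝ) / √(T : ℝ)
          * √((d : ℝ) / min (d : ℝ) ((2 : ℝ) ^ r)))
        ((1 / (12 * √58)) * D * B / √(T : ℝ) * √((d : ℝ) / min (d : ℝ) (r : ℝ))))
      ≤ ⨆ X ∈ InfoOpt.domains d p D,
          InfoOpt.minmaxError X (InfoOpt.convexLipschitzFamily X p B) T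
            (InfoOpt.comChannels d r) := by
  have hp1 : 1 ≤ p := one_le_two.trans hp.le
  have hd0 : (0 : ℝ) < d := by positivity
  have hm0 : 0 < min ((2 : ℝ) ^ r) (d : ℝ) := lt_min (by positivity) hd0
  have hT0 : 0 < T := by
    have : (0 : ℝ) < T := lt_of_lt_of_le (by positivity) hT
    exact_mod_cast this
  have hT1 : (d : ℝ) ^ 2 ≤ 4 * (T * min ((2 : ℝ) ^ r) d) := by
    have h := mul_le_mul_of_nonneg_right hT hm0.le
    have h1 : (1 / 4 : ℝ) * ((d : ℝ) ^ 2 / min ((2 : ℝ) ^ r) (d : ℝ)) * min ((2 : ℝ) ^ r) (d : ℝ)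
        = (d : ℝ) ^ 2 / 4 := by field_simp
    linarith
  have hT2 : (d : ℝ) ≤ 4 * T := by
    have h : (T : ℝ) * min ((2 : ℝ) ^ r) d ≤ T * d := by
      gcongr
      exact min_le_right _ _
    nlinarith
  refine le_trans ?_ (le_iSup₂_of_le (f := fun X (_ : X ∈ InfoOpt.domains d p D) =>
    InfoOpt.minmaxError X (InfoOpt.convexLipschitzFamily X p B) T (InfoOpt.comChannels d r)) _
    (InfoOpt.cube_mem_domains hd hp1 hD) le_rfl)
  rcases max_choice
      ((1 / (12 * √58)) * D * B * (d : ℝ) ^ (1 / 2 - (p⁻¹).toReal : ℝ) / √(T : ℝ)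
          * √((d : ℝ) / min (d : ℝ) ((2 : ℝ) ^ r)))
      ((1 / (12 * √58)) * D * B / √(T : ℝ) * √((d : ℝ) / min (d : ℝ) (r : ℝ))) with h | h <;> rw [h]
  exacts [InfoOpt.le_minmaxError_coord hd hB hD hT0 hT1,
    InfoOpt.le_minmaxError_prod hd hr hp1 hB hD hT0 hT2]
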